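/- For a finite group $K$ let $B(K)$ be its Burnside ring, i.e. the Grothendieck ring of finite left $K$-sets, with $[X]+[Y]=[X\sqcup Y]$ and $[X][Y]=[X\times Y]$; for $H\le K$ let $\mathrm{Res}^K_H\colon B(K)\to B(H)$ be the ring homomorphism restricting the action to $H$, and let $a\mapsto |a^H|$ be the ring homomorphism $B(K)\to\mathbb Z$ with $[X]\mapsto |X^H|$, the number of $H$-fixed points. For a fusion system $\mathcal F$ on a finite $p$-group $S$, let $B(\mathcal F)\subseteq B(S)$ be the subring of all $b\in B(S)$ with $|b^P|=|b^Q|$ whenever $P,Q\le S$ are isomorphic in $\mathcal F$. Theorem 7.1. Let $G$ be a finite group, $p$ a prime, $S$ a Sylow $p$-subgroup of $G$, and $\mathcal F=\mathcal F_S(G)$ the fusion system on $S$ whose morphisms $P\to Q$ (for $P,Q\le S$) are the group homomorphisms given by conjugation by an element of $G$. Then the image of $\mathrm{Res}^G_S\colon B(G)\to B(S)$ is exactly $B(\mathcal F)$. Moreover, there is an injective ring homomorphism $t^G_S\colon B(\mathcal F)\to B(G)$ such that $\mathrm{Res}^G_S(t^G_S(b))=b$ for all $b\in B(\mathcal F)$,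 and such that $|t^G_S(b)^H|=|b^P|$ for all $b\in B(\mathcal F)$, all $H\le G$ and all $P\le S$ that are $G$-conjugate to a Sylow $p$-subgroup of $H$. -/

import Mathlib

universe u

/-! ### The Grothendieck ring of a commutative semiring -/

/-- The Grothendieck ring of a commutative semiring `R`: the Grothendieck group of the additive
monoid `R`, with the multiplication extended biadditively. -/
def GrothendieckRing (R : Type*) [CommSemiring R] : Type _ :=
  Algebra.GrothendieckAddGroup R

namespace GrothendieckRing

section Basic

variable {R : Type*} [CommSemiring R]

noncomputable instance : AddCommGroup (GrothendieckRing R) :=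
  inferInstanceAs (AddCommGroup (Algebra.GrothendieckAddGroup R))

/-- The canonical additive map from `R` to its Grothendieck ring. -/
noncomputable def ofAdd : R →+ GrothendieckRing R :=
  Algebra.GrothendieckAddGroup.of

/-- The universal property of the Grothendieck group. -/
noncomputable def liftAdd {A : Type*} [AddCommGroup A] (f : R →+ A) : GrothendieckRing R →+ A :=
  Algebra.GrothendieckAddGroup.lift f

theorem liftAdd_ofAdd {A : Type*} [AddCommGroup A] (f : R →+ A) (r : R) :
    liftAdd f (ofAdd r) = f r :=
  DFunLike.congr_fun (Algebra.GrothendieckAddGroup.lift.symm_apply_apply f) r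

theorem hom_ext {A : Type*} [AddCommGroup A] {f g : GrothendieckRing R →+ A}
    (h : ∀ r, f (ofAdd r) = g (ofAdd r)) : f = g :=
  Algebra.GrothendieckAddGroup.lift.symm.injective (AddMonoidHom.ext h)

/-- Every element of the Grothendieck ring is a difference of two elements of `R`. -/
theorem exists_sub (x : GrothendieckRing R) : ∃ a b : R, x = ofAdd a - ofAdd b := by
  induction x using AddLocalization.ind with
  | H y =>
    refine ⟨y.1, y.2, ?_⟩
    have h : (AddLocalization.mk y.1 y.2 : Algebra.GrothendieckAddGroup R) =
        AddLocalization.mk y.1 0 - AddLocalization.mk (y.2 : R) 0 := by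
      rw [Algebra.GrothendieckAddGroup.mk_sub_mk]
      congr 1
      · simp
      · ext; simp
    exact h

/-- The multiplication, as a biadditive map: the unique one with `[a] * [b] = [a * b]`. -/
noncomputable def mulHom : GrothendieckRing R →+ GrothendieckRing R →+ GrothendieckRing R :=
  liftAdd
    { toFun := fun a => liftAdd (ofAdd.comp (AddMonoidHom.mulLeft a))
      map_zero' := hom_ext fun r => by simp [liftAdd_ofAdd]
      map_add' := fun a b => hom_ext fun r => by simp [liftAdd_ofAdd, add_mul] }

theorem mulHom_ofAdd (a b : R) : mulHom (ofAdd a) (ofAdd b) = ofAdd (a * b) := by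
  simp [mulHom, liftAdd_ofAdd]

noncomputable instance : CommRing (GrothendieckRing R) :=
  { (inferInstance : AddCommGroup (GrothendieckRing R)) with
    mul := fun x y => mulHom x y
    one := ofAdd 1
    left_distrib := fun x y z => map_add (mulHom x) y z
    right_distrib := fun x y z => by
      change mulHom (x + y) z = mulHom x z + mulHom y z
      simp
    zero_mul := fun x => by
      change mulHom 0 x = 0
      simp
    mul_zero := fun x => map_zero (mulHom x)
    mul_assoc := fun x y z => by
      change mulHom (mulHom x y) z = mulHom x (mulHom y z)
      obtain ⟨a, a', rfl⟩ := exists_sub x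
      obtain ⟨b, b', rfl⟩ := exists_sub y
      obtain ⟨c, c', rfl⟩ := exists_sub z
      simp only [map_sub, AddMonoidHom.sub_apply, mulHom_ofAdd, mul_assoc]
    one_mul := fun x => by
      change mulHom (ofAdd 1) x = x
      obtain ⟨a, a', rfl⟩ := exists_sub x
      simp only [map_sub, mulHom_ofAdd, one_mul]
    mul_one := fun x => by
      change mulHom x (ofAdd 1) = x
      obtain ⟨a, a', rfl⟩ := exists_sub x
      simp only [map_sub, AddMonoidHom.sub_apply, mulHom_ofAdd, mul_one]
    mul_comm := fun x y => by
      change mulHom x y = mulHom y x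
      obtain ⟨a, a', rfl⟩ := exists_sub x
      obtain ⟨b, b', rfl⟩ := exists_sub y
      simp only [map_sub, AddMonoidHom.sub_apply, mulHom_ofAdd, mul_comm a, mul_comm a']
      abel }

/-- The canonical ring map from `R` to its Grothendieck ring. -/
noncomputable def of : R →+* GrothendieckRing R :=
  { ofAdd with
    map_one' := rfl
    map_mul' := fun a b => (mulHom_ofAdd a b).symm }

/-- The universal property of the Grothendieck ring. -/
noncomputable def lift {A : Type*} [CommRing A] (f : R →+* A) : GrothendieckRing R →+* A :=
  { liftAdd f.toAddMonoidHom with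
    map_one' := by
      change liftAdd f.toAddMonoidHom (ofAdd 1) = 1
      simp [liftAdd_ofAdd]
    map_mul' := fun x y => by
      change liftAdd f.toAddMonoidHom (mulHom x y) =
        liftAdd f.toAddMonoidHom x * liftAdd f.toAddMonoidHom y
      obtain ⟨a, a', rfl⟩ := exists_sub x
      obtain ⟨b, b', rfl⟩ := exists_sub y
      simp only [map_sub, AddMonoidHom.sub_apply, mulHom_ofAdd, liftAdd_ofAdd,
        RingHom.toAddMonoidHom_eq_coe, AddMonoidHom.coe_coe, map_mul]
      ring }

theorem lift_of {A : Type*} [CommRing A] (f : R →+* A) (r : R) : lift f (of r) = f r :=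
  liftAdd_ofAdd f.toAddMonoidHom r

end Basic

end GrothendieckRing

/-! ### Finite `G`-sets and their isomorphism classes -/

/-- A finite (left) `G`-set. -/
structure FinGSet (G : Type u) [Group G] : Type (u + 1) where
  carrier : Type u
  [action : MulAction G carrier]
  [finite : Finite carrier]

namespace FinGSet

attribute [instance] FinGSet.action FinGSet.finite

section Basic

variable {G : Type u} [Group G]

/-- Two `G`-sets are isomorphic if there is a `G`-equivariant bijection between them. -/
def Iso (X Y : FinGSet G) : Prop :=
  ∃ e : X.carrier ≃ Y.carrier, ∀ (g : G) (x : X.carrier), e (g • x) = g • e x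

instance isoSetoid : Setoid (FinGSet G) where
  r := Iso
  iseqv :=
    { refl := fun _ => ⟨Equiv.refl _, fun _ _ => rfl⟩
      symm := fun ⟨e, he⟩ => ⟨e.symm, fun g y => e.injective (by simp [he])⟩
      trans := fun ⟨e, he⟩ ⟨f, hf⟩ => ⟨e.trans f, fun g x => by simp [he, hf]⟩ }

/-- The empty `G`-set. -/
def empty : FinGSet G :=
  letI : MulAction G PEmpty.{u + 1} :=
    { smul := fun _ x => x
      one_smul := fun _ => rfl
      mul_smul := fun _ _ _ => rfl }
  ⟨PEmpty.{u + 1}⟩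

/-- The one-point `G`-set. -/
def point : FinGSet G :=
  ⟨PUnit.{u + 1}⟩

/-- The disjoint union, `G` acting on each part. -/
def sum (X Y : FinGSet G) : FinGSet G :=
  ⟨X.carrier ⊕ Y.carrier⟩

/-- The direct product, with the diagonal action. -/
def prod (X Y : FinGSet G) : FinGSet G :=
  ⟨X.carrier × Y.carrier⟩

/-- A `G`-set, regarded as an `H`-set for a subgroup `H` of `G`. -/
def restrict (H : Subgroup G) (X : FinGSet G) : FinGSet H :=
  ⟨X.carrier⟩

theorem sum_iso {X X' Y Y' : FinGSet G} : Iso X X' → Iso Y Y' → Iso (sum X Y) (sum X' Y') :=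
  fun ⟨e, he⟩ ⟨f, hf⟩ => ⟨Equiv.sumCongr e f, by
    rintro g (x | x)
    · exact congrArg Sum.inl (he g x)
    · exact congrArg Sum.inr (hf g x)⟩

theorem prod_iso {X X' Y Y' : FinGSet G} : Iso X X' → Iso Y Y' → Iso (prod X Y) (prod X' Y') :=
  fun ⟨e, he⟩ ⟨f, hf⟩ => ⟨Equiv.prodCongr e f, by
    rintro g ⟨x, y⟩
    exact Prod.ext (he g x) (hf g y)⟩

/-- The number `|X^H|` of fixed points of `H` on `X`. -/
noncomputable def numFixed (H : Subgroup G) (X : FinGSet G) : ℕ :=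
  Nat.card (MulAction.fixedPoints H X.carrier)

theorem numFixed_congr (H : Subgroup G) {X Y : FinGSet G} :
    Iso X Y → numFixed H X = numFixed H Y :=
  fun ⟨e, he⟩ => Nat.card_congr (e.subtypeEquiv fun x => by
    refine forall_congr' fun h => ?_
    change (h : G) • x = x ↔ (h : G) • e x = e x
    rw [← he, e.injective.eq_iff])

end Basic

end FinGSet

/-- The isomorphism classes of finite `G`-sets. -/
def FinGSetClass (G : Type u) [Group G] : Type (u + 1) :=
  Quotient (FinGSet.isoSetoid (G := G))

namespace FinGSetClass

section Basic

variable {G : Type u} [Group G]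

instance : Zero (FinGSetClass G) :=
  ⟨Quotient.mk _ FinGSet.empty⟩

instance : Add (FinGSetClass G) :=
  ⟨Quotient.map₂ FinGSet.sum fun _ _ h _ _ h' => FinGSet.sum_iso h h'⟩

/-- The isomorphism classes of finite `G`-sets form a commutative semiring, with
`[X] + [Y] = [X ⊔ Y]` and `[X] * [Y] = [X × Y]`. -/
instance : CommSemiring (FinGSetClass G) where
  mul := Quotient.map₂ FinGSet.prod fun _ _ h _ _ h' => FinGSet.prod_iso h h'
  one := Quotient.mk _ FinGSet.point
  nsmul := nsmulRec
  add_assoc := by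
    rintro ⟨X⟩ ⟨Y⟩ ⟨Z⟩
    refine Quotient.sound ⟨Equiv.sumAssoc _ _ _, ?_⟩
    rintro g ((x | x) | x) <;> rfl
  zero_add := by
    rintro ⟨X⟩
    refine Quotient.sound ⟨Equiv.emptySum PEmpty _, ?_⟩
    rintro g (x | x)
    · exact x.elim
    · rfl
  add_zero := by
    rintro ⟨X⟩
    refine Quotient.sound ⟨Equiv.sumEmpty _ PEmpty, ?_⟩
    rintro g (x | x)
    · rfl
    · exact x.elim
  add_comm := by
    rintro ⟨X⟩ ⟨Y⟩
    refine Quotient.sound ⟨Equiv.sumComm _ _, ?_⟩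
    rintro g (x | x) <;> rfl
  mul_assoc := by
    rintro ⟨X⟩ ⟨Y⟩ ⟨Z⟩
    exact Quotient.sound ⟨Equiv.prodAssoc _ _ _, fun _ _ => rfl⟩
  one_mul := by
    rintro ⟨X⟩
    exact Quotient.sound ⟨Equiv.punitProd _, fun _ _ => rfl⟩
  mul_one := by
    rintro ⟨X⟩
    exact Quotient.sound ⟨Equiv.prodPUnit _, fun _ _ => rfl⟩
  mul_comm := by
    rintro ⟨X⟩ ⟨Y⟩
    exact Quotient.sound ⟨Equiv.prodComm _ _, fun _ _ => rfl⟩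
  zero_mul := by
    rintro ⟨X⟩
    exact Quotient.sound ⟨Equiv.pemptyProd _, fun _ x => x.1.elim⟩
  mul_zero := by
    rintro ⟨X⟩
    exact Quotient.sound ⟨Equiv.prodPEmpty _, fun _ x => x.2.elim⟩
  left_distrib := by
    rintro ⟨X⟩ ⟨Y⟩ ⟨Z⟩
    refine Quotient.sound ⟨Equiv.prodSumDistrib _ _ _, ?_⟩
    rintro g ⟨x, (y | y)⟩ <;> rfl
  right_distrib := by
    rintro ⟨X⟩ ⟨Y⟩ ⟨Z⟩
    refine Quotient.sound ⟨Equiv.sumProdDistrib _ _ _, ?_⟩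
    rintro g ⟨(x | x), y⟩ <;> rfl

/-- Restriction of isomorphism classes to a subgroup. -/
def res (H : Subgroup G) : FinGSetClass G →+* FinGSetClass H where
  toFun := Quotient.map (FinGSet.restrict H) fun _ _ ⟨e, he⟩ => ⟨e, fun h x => he h x⟩
  map_zero' := Quotient.sound ⟨Equiv.refl PEmpty, fun _ x => x.elim⟩
  map_one' := Quotient.sound ⟨Equiv.refl PUnit, fun _ _ => rfl⟩
  map_add' := by
    rintro ⟨X⟩ ⟨Y⟩
    refine Quotient.sound ⟨Equiv.refl (X.carrier ⊕ Y.carrier), ?_⟩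
    rintro g (x | x) <;> rfl
  map_mul' := by
    rintro ⟨X⟩ ⟨Y⟩
    exact Quotient.sound ⟨Equiv.refl (X.carrier × Y.carrier), fun _ _ => rfl⟩

/-- The number of `H`-fixed points of an isomorphism class. -/
noncomputable def mark (H : Subgroup G) : FinGSetClass G →+* ℕ where
  toFun := Quotient.lift (FinGSet.numFixed H) fun _ _ h => FinGSet.numFixed_congr H h
  map_zero' := by
    change Nat.card (MulAction.fixedPoints H (FinGSet.empty (G := G)).carrier) = 0
    have : IsEmpty (FinGSet.empty (G := G)).carrier := inferInstanceAs (IsEmpty PEmpty)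
    simp
  map_one' := by
    change Nat.card (MulAction.fixedPoints H PUnit.{u + 1}) = 1
    have : MulAction.fixedPoints H PUnit.{u + 1} = Set.univ :=
      Set.eq_univ_of_forall fun _ _ => rfl
    rw [this]
    simp
  map_add' := by
    rintro ⟨X⟩ ⟨Y⟩
    change Nat.card (MulAction.fixedPoints H (X.carrier ⊕ Y.carrier)) =
      Nat.card (MulAction.fixedPoints H X.carrier) + Nat.card (MulAction.fixedPoints H Y.carrier)
    rw [← Nat.card_sum]
    refine Nat.card_congr
      { toFun := fun x => match x with
          | ⟨Sum.inl a, h⟩ => Sum.inl ⟨a, fun k => Sum.inl_injective (h k)⟩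
          | ⟨Sum.inr a, h⟩ => Sum.inr ⟨a, fun k => Sum.inr_injective (h k)⟩
        invFun := fun x => match x with
          | Sum.inl a => ⟨Sum.inl a.1, fun k => congrArg Sum.inl (a.2 k)⟩
          | Sum.inr a => ⟨Sum.inr a.1, fun k => congrArg Sum.inr (a.2 k)⟩
        left_inv := ?_
        right_inv := ?_ }
    · rintro ⟨x | x, h⟩ <;> rfl
    · rintro (x | x) <;> rfl
  map_mul' := by
    rintro ⟨X⟩ ⟨Y⟩
    change Nat.card (MulAction.fixedPoints H (X.carrier × Y.carrier)) =
      Nat.card (MulAction.fixedPoints H X.carrier) * Nat.card (MulAction.fixedPoints H Y.carrier)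
    rw [← Nat.card_prod]
    exact Nat.card_congr
      { toFun := fun x => (⟨x.1.1, fun k => congrArg Prod.fst (x.2 k)⟩,
          ⟨x.1.2, fun k => congrArg Prod.snd (x.2 k)⟩)
        invFun := fun x => ⟨(x.1.1, x.2.1), fun k => Prod.ext (x.1.2 k) (x.2.2 k)⟩
        left_inv := fun _ => rfl
        right_inv := fun _ => rfl }

end Basic

end FinGSetClass

/-! ### The Burnside ring -/

/-- The Burnside ring `B(G)`: the Grothendieck ring of finite `G`-sets. -/
abbrev BurnsideRing (G : Type u) [Group G] : Type (u + 1) :=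
  GrothendieckRing (FinGSetClass G)

namespace BurnsideRing

section Basic

variable {G : Type u} [Group G]

/-- The restriction map `B(G) → B(H)`, with `[X] ↦ [X]` for every finite `G`-set `X`. -/
noncomputable def res (H : Subgroup G) : BurnsideRing G →+* BurnsideRing H :=
  GrothendieckRing.lift (GrothendieckRing.of.comp (FinGSetClass.res H))

/-- The mark `a ↦ |a^H|`, that is, the ring map `B(G) → ℤ` with `[X] ↦ |X^H|`. -/
noncomputable def mark (H : Subgroup G) : BurnsideRing G →+* ℤ :=
  GrothendieckRing.lift ((Nat.castRingHom ℤ).comp (FinGSetClass.mark H))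

end Basic

end BurnsideRing

/-! ### Fusion systems -/

/-- A fusion system on `S`: a category whose objects are the subgroups of `S` and whose morphisms
are injective group homomorphisms (identities are among the conjugations by elements of `S`). -/
structure FusionSystem (S : Type*) [Group S] where
  /-- The set of morphisms from `P` to `Q`. -/
  Hom : ∀ P Q : Subgroup S, Set (P →* Q)
  injective : ∀ {P Q : Subgroup S} {φ : P →* Q}, φ ∈ Hom P Q → Function.Injective φ
  comp_mem : ∀ {P Q R : Subgroup S} {φ : P →* Q} {ψ : Q →* R},
    φ ∈ Hom P Q → ψ ∈ Hom Q R → ψ.comp φ ∈ Hom P R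
  conj_mem : ∀ {P Q : Subgroup S} {φ : P →* Q},
    (∃ s : S, ∀ x : P, (φ x : S) = s * x * s⁻¹) → φ ∈ Hom P Q
  /-- Every morphism is an isomorphism of the category followed by an inclusion. -/
  exists_iso : ∀ {P Q : Subgroup S} {φ : P →* Q}, φ ∈ Hom P Q →
    ∃ (R : Subgroup S) (h : R ≤ Q) (e : P ≃* R), e.toMonoidHom ∈ Hom P R ∧
      e.symm.toMonoidHom ∈ Hom R P ∧ φ = (Subgroup.inclusion h).comp e.toMonoidHom

namespace FusionSystem

/-- `P` and `Q` are `F`-conjugate: there is an isomorphism from `P` to `Q` in `F`. -/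
def IsConj {S : Type*} [Group S] (F : FusionSystem S) (P Q : Subgroup S) : Prop :=
  ∃ e : P ≃* Q, e.toMonoidHom ∈ F.Hom P Q ∧ e.symm.toMonoidHom ∈ F.Hom Q P

/-- The Frobenius fusion system `F_S(G)`: the morphisms `P → Q` are the homomorphisms given by
conjugation by an element of `G`. -/
def frobenius {G : Type*} [Group G] (S : Subgroup G) : FusionSystem S where
  Hom P Q := {φ | ∃ g : G, ∀ x : P, ((φ x : S) : G) = g * ((x : S) : G) * g⁻¹}
  injective := by
    rintro P Q φ ⟨g, hg⟩ x y hxy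
    have h : g * ((x : S) : G) * g⁻¹ = g * ((y : S) : G) * g⁻¹ := by rw [← hg, ← hg, hxy]
    exact Subtype.ext (Subtype.ext (mul_left_cancel (mul_right_cancel h)))
  comp_mem := by
    rintro P Q R φ ψ ⟨g, hg⟩ ⟨k, hk⟩
    refine ⟨k * g, fun x => ?_⟩
    rw [MonoidHom.comp_apply, hk, hg]
    group
  conj_mem := by
    rintro P Q φ ⟨s, hs⟩
    exact ⟨s, fun x => by rw [hs]; rfl⟩
  exists_iso := by
    rintro P Q φ ⟨g, hg⟩
    have hinj : Function.Injective ((Q.subtype).comp φ) := by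
      intro x y hxy
      have hxy' : (φ x : S) = φ y := hxy
      have h : g * ((x : S) : G) * g⁻¹ = g * ((y : S) : G) * g⁻¹ := by rw [← hg, ← hg, hxy']
      exact Subtype.ext (Subtype.ext (mul_left_cancel (mul_right_cancel h)))
    refine ⟨((Q.subtype).comp φ).range, ?_, MonoidHom.ofInjective hinj, ⟨g, hg⟩, ⟨g⁻¹, ?_⟩, ?_⟩
    · rintro _ ⟨x, rfl⟩
      exact (φ x).2
    · intro y
      obtain ⟨x, rfl⟩ := (MonoidHom.ofInjective hinj).surjective y
      have h : (((MonoidHom.ofInjective hinj x : _) : S) : G) = g * ((x : S) : G) * g⁻¹ := hg x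
      rw [h]
      simp [mul_assoc]
    · ext x
      rfl

/-- The Burnside ring `B(F)` of a fusion system `F` on `S`: the subring of all `a ∈ B(S)` with
`|a^P| = |a^Q|` whenever `P` and `Q` are isomorphic in `F`. -/
def burnsideRing {S : Type u} [Group S] (F : FusionSystem S) : Subring (BurnsideRing S) where
  carrier := {a | ∀ P Q : Subgroup S, F.IsConj P Q →
    BurnsideRing.mark P a = BurnsideRing.mark Q a}
  mul_mem' := fun ha hb P Q h => by rw [map_mul, map_mul, ha P Q h, hb P Q h]
  one_mem' := fun P Q _ => by rw [map_one, map_one]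
  add_mem' := fun ha hb P Q h => by rw [map_add, map_add, ha P Q h, hb P Q h]
  zero_mem' := fun P Q _ => by rw [map_zero, map_zero]
  neg_mem' := fun ha P Q h => by rw [map_neg, map_neg, ha P Q h]

end FusionSystem

/-! An element of the Burnside ring of a finite group is determined by its marks (`ext_mark`), so
the transfer of a stable `b` must have at `H` the mark `ξ(H) = |b^P|`, where `P ≤ S` is conjugate to
a Sylow `p`-subgroup of `H`. Sylow's theorem and the stability of `b` make `ξ` a well-defined class
function. The task is to show that `ξ` is the family of marks of an element of B(G).

A class function `ξ` is such a family as soon as `|Q|` divides the sum of `ξ(H⟨n⟩)` over `n ∈ Q`,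
for every prime `q`, every `H ≤ G` and every `q`-subgroup `Q` of N(H) (`exists_mark_eq`).
Conversely, marks satisfy these congruences, by counting the orbits of `Q` on the `H`-fixed points
(`card_dvd_sum_mark`).

For `q ≠ p`, a Sylow `p`-subgroup of `H` is still one of `H⟨n⟩`, so all terms are equal. For `q =
p`, a Sylow `p`-subgroup `T ≥ Q` of N(H) gives one `P = T ∩ H` such that `P⟨n⟩` is Sylow in `H⟨n⟩`
for all `n ∈ Q`; conjugating `T` into `S` turns the sum into a Cauchy–Frobenius sum for `b` itself.

Marks are ring homomorphisms, so the transfer is one too. It is a section of restriction, hence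
injective, because a subgroup of `S` is its own Sylow `p`-subgroup. Restrictions are stable because
marks are constant on `G`-conjugacy classes. -/

open Subgroup

/-! ### Sylow subgroups of subgroups -/

section Sylow

variable {G : Type*} [Group G]

/-- The index of `M ⊓ H` in `H ⊔ M` is computed through `H` and through `M`; the factors `[H ⊔ M :
H]` and `[M : M ⊓ H]` agree and cancel. -/
theorem Subgroup.relIndex_sup_self_of_normal [Finite G] (H M : Subgroup G) [H.Normal] :
    M.relIndex (H ⊔ M) = M.relIndex H := by
  have h1 := relIndex_mul_relIndex (M ⊓ H) H (H ⊔ M) inf_le_right le_sup_left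
  have h2 := relIndex_mul_relIndex (M ⊓ H) M (H ⊔ M) inf_le_left le_sup_right
  rw [inf_relIndex_right] at h1
  rw [inf_relIndex_left, ← relIndex_sup_left M H, mul_comm] at h2
  have h3 : H.relIndex (H ⊔ M) ≠ 0 := by
    rw [Subgroup.relIndex]; exact FiniteIndex.index_ne_zero
  exact Nat.eq_of_mul_eq_mul_right (Nat.pos_of_ne_zero h3) (h2.trans h1.symm)

theorem Subgroup.relIndex_sup_self_of_le_normalizer [Finite G] {H M : Subgroup G}
    (h : M ≤ normalizer (H : Set G)) : M.relIndex (H ⊔ M) = M.relIndex H := by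
  have h' : H ⊔ M ≤ normalizer (H : Set G) := sup_le le_normalizer h
  rw [← relIndex_subgroupOf h', ← relIndex_subgroupOf (le_normalizer (H := H)),
    subgroupOf_sup le_normalizer h]
  exact relIndex_sup_self_of_normal _ _

/-- `P` is a Sylow `p`-subgroup of `H`, both being subgroups of an ambient group. -/
def Subgroup.IsSylowIn (p : ℕ) (P H : Subgroup G) : Prop :=
  ∃ Q : Sylow p H, Q.toSubgroup.map H.subtype = P

variable {p : ℕ} [Fact p.Prime]

theorem Subgroup.isSylowIn_iff [Finite G] {P H : Subgroup G} :
    IsSylowIn p P H ↔ P ≤ H ∧ IsPGroup p P ∧ ¬ p ∣ P.relIndex H := by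
  constructor
  · rintro ⟨Q, rfl⟩
    refine ⟨map_subtype_le _, Q.2.map _, ?_⟩
    have : (Q.toSubgroup.map H.subtype).subgroupOf H = Q.toSubgroup :=
      comap_map_eq_self_of_injective H.subtype_injective _
    rw [relIndex, this]
    exact Q.not_dvd_index
  · rintro ⟨h1, h2, h3⟩
    have h4 : IsPGroup p (P.subgroupOf H) := h2.comap_of_injective _ H.subtype_injective
    refine ⟨h4.toSylow h3, ?_⟩
    exact (subgroupOf_map_subtype P H).trans (inf_eq_left.2 h1)

theorem Subgroup.IsSylowIn.map_conj [Finite G] {P H : Subgroup G} (h : IsSylowIn p P H) (g : G) :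
    IsSylowIn p (P.map (MulAut.conj g).toMonoidHom) (H.map (MulAut.conj g).toMonoidHom) := by
  rw [isSylowIn_iff] at h ⊢
  refine ⟨map_mono h.1, h.2.1.map _, ?_⟩
  rw [relIndex_map_map_of_injective _ _ (MulAut.conj g).injective]
  exact h.2.2

theorem Subgroup.map_conj_mul (H : Subgroup G) (g k : G) :
    (H.map (MulAut.conj g).toMonoidHom).map (MulAut.conj k).toMonoidHom =
      H.map (MulAut.conj (k * g)).toMonoidHom := by
  rw [map_map]
  congr 1
  ext x
  simp

theorem Subgroup.map_conj_one (H : Subgroup G) :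
    H.map (MulAut.conj (1 : G)).toMonoidHom = H := by
  ext x
  simp

/-- Sylow subgroups of a subgroup are conjugate in the ambient group. -/
theorem Subgroup.IsSylowIn.exists_conj [Finite G] {P P' H : Subgroup G} (h : IsSylowIn p P H)
    (h' : IsSylowIn p P' H) : ∃ g : G, P.map (MulAut.conj g).toMonoidHom = P' := by
  obtain ⟨Q, rfl⟩ := h
  obtain ⟨Q', rfl⟩ := h'
  obtain ⟨k, rfl⟩ := MulAction.exists_smul_eq H Q Q'
  refine ⟨k, ?_⟩
  rw [map_map]
  exact (map_map (K := Q.toSubgroup) (g := H.subtype) (f := (MulAut.conj k).toMonoidHom)).symm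

theorem IsPGroup.exists_map_conj_le [Finite G] (S : Sylow p G) {P : Subgroup G}
    (h : IsPGroup p P) : ∃ g : G, P.map (MulAut.conj g).toMonoidHom ≤ S := by
  obtain ⟨T, hT⟩ := h.exists_le_sylow
  obtain ⟨g, rfl⟩ := MulAction.exists_smul_eq G T S
  exact ⟨g, map_mono hT⟩

/-- A `p`-subgroup `Q` normalizing `H` lies in a `p`-subgroup `T` such that, for some Sylow
`p`-subgroup `P ≤ T` of `H`, normalized by `Q`, each `P ⊔ ⟨n⟩` with `n ∈ Q` is a Sylow
`p`-subgroup of `H ⊔ ⟨n⟩`. -/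
theorem IsPGroup.exists_isSylowIn_sup_zpowers [Finite G] {H Q : Subgroup G} (hQ : IsPGroup p Q)
    (hQH : Q ≤ normalizer (H : Set G)) :
    ∃ T P : Subgroup G, IsPGroup p T ∧ Q ≤ T ∧ P ≤ T ∧ Q ≤ normalizer (P : Set G) ∧
      ∀ n ∈ Q, IsSylowIn p (P ⊔ zpowers n) (H ⊔ zpowers n) := by
  -- `T` is a Sylow `p`-subgroup of the normalizer of `H` that contains `Q`.
  obtain ⟨T', hT'⟩ := (hQ.comap_of_injective (normalizer (H : Set G)).subtype
    (subtype_injective _)).exists_le_sylow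
  set T := T'.toSubgroup.map (normalizer (H : Set G)).subtype
  have hQT : Q ≤ T := fun x hx => ⟨⟨x, hQH hx⟩, hT' hx, rfl⟩
  have hT : IsSylowIn p T (normalizer (H : Set G)) := ⟨T', rfl⟩
  rw [isSylowIn_iff] at hT
  obtain ⟨hTN, hTp, hTi⟩ := hT
  -- `[H : T ⊓ H] = [H ⊔ T : T]` divides `[N(H) : T]`, which is prime to `p`.
  have hTH : ¬ p ∣ T.relIndex H := by
    rw [← relIndex_sup_self_of_le_normalizer hTN]
    refine fun h => hTi (h.trans ?_)
    rw [← relIndex_mul_relIndex T (H ⊔ T) _ le_sup_right (sup_le le_normalizer hTN)]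
    exact dvd_mul_right _ _
  refine ⟨T, T ⊓ H, hTp, hQT, inf_le_left, ?_, fun n hn => ?_⟩
  · intro n hn
    have h1 := (le_normalizer (H := T)) (hQT hn)
    have h2 := hQH hn
    rw [mem_normalizer_iff] at h1 h2 ⊢
    intro x
    rw [mem_inf, mem_inf, h1 x, h2 x]
  · have hnT : zpowers n ≤ T := by simpa using hQT hn
    have hle : T ⊓ H ⊔ zpowers n ≤ T := sup_le inf_le_left hnT
    rw [isSylowIn_iff]
    refine ⟨sup_le_sup_right inf_le_right _, hTp.to_le hle, ?_⟩
    -- In this form the index of `(T ⊓ H)⟨n⟩` in `H⟨n⟩` becomes its relative index in `H`, a divisor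
    -- of `[H : T ⊓ H]`.
    have h1 : H ⊔ zpowers n = H ⊔ (T ⊓ H ⊔ zpowers n) := by
      rw [← sup_assoc, sup_eq_left.2 (inf_le_right : T ⊓ H ≤ H)]
    rw [h1, relIndex_sup_self_of_le_normalizer (hle.trans hTN)]
    refine fun h => hTH (h.trans ?_)
    rw [← inf_relIndex_right T H]
    exact relIndex_dvd_of_le_left _ le_sup_left

end Sylow

namespace BurnsideRing

/-! ### Marks: conjugation invariance, congruences, injectivity and image -/

section Marks

variable {G : Type u} [Group G]

/-- The class of a finite `G`-set in the Burnside ring. -/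
noncomputable def ofSet (X : FinGSet G) : BurnsideRing G :=
  GrothendieckRing.of (Quotient.mk _ X : FinGSetClass G)

theorem ofSet_congr {X Y : FinGSet G} (h : FinGSet.Iso X Y) : ofSet X = ofSet Y :=
  congrArg GrothendieckRing.of (Quotient.sound h : (Quotient.mk _ X : FinGSetClass G) = _)

theorem ofSet_sum (X Y : FinGSet G) : ofSet (X.sum Y) = ofSet X + ofSet Y :=
  (GrothendieckRing.of (R := FinGSetClass G)).map_add (Quotient.mk _ X) (Quotient.mk _ Y)

theorem exists_ofSet_sub (x : BurnsideRing G) : ∃ X Y : FinGSet G, x = ofSet X - ofSet Y := by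
  obtain ⟨⟨X⟩, ⟨Y⟩, h⟩ := GrothendieckRing.exists_sub x
  exact ⟨X, Y, h⟩

theorem mark_ofSet (H : Subgroup G) (X : FinGSet G) :
    mark H (ofSet X) = Nat.card (MulAction.fixedPoints H X.carrier) :=
  GrothendieckRing.lift_of _ _

theorem mark_res (S : Subgroup G) (P : Subgroup S) (x : BurnsideRing G) :
    mark P (res S x) = mark (P.map S.subtype) x := by
  obtain ⟨X, Y, rfl⟩ := exists_ofSet_sub x
  have key : ∀ X : FinGSet G, mark P (res S (ofSet X)) = mark (P.map S.subtype) (ofSet X) := by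
    intro X
    have h : res S (ofSet X) = ofSet (X.restrict S) := GrothendieckRing.lift_of _ _
    rw [h, mark_ofSet, mark_ofSet]
    congr 1
    refine Nat.card_congr (Equiv.subtypeEquivRight fun x => ?_)
    constructor
    · rintro h ⟨_, y, hy, rfl⟩
      exact h ⟨y, hy⟩
    · rintro h ⟨y, hy⟩
      exact h ⟨y, y, hy, rfl⟩
  rw [map_sub, map_sub, map_sub, key, key]

/-- Translation by `g` carries the fixed points of `H` onto those of its conjugate. -/
theorem mark_map_conj (H : Subgroup G) (g : G) (x : BurnsideRing G) :
    mark (H.map (MulAut.conj g).toMonoidHom) x = mark H x := by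
  obtain ⟨X, Y, rfl⟩ := exists_ofSet_sub x
  have key : ∀ X : FinGSet G,
      mark (H.map (MulAut.conj g).toMonoidHom) (ofSet X) = mark H (ofSet X) := by
    intro X
    rw [mark_ofSet, mark_ofSet]
    congr 1
    refine (Nat.card_congr ((MulAction.toPerm g).subtypeEquiv fun x => ?_)).symm
    constructor
    · rintro h ⟨_, y, hy, rfl⟩
      have h1 : y • x = x := h ⟨y, hy⟩
      change (g * y * g⁻¹) • g • x = g • x
      rw [mul_smul, mul_smul, inv_smul_smul, h1]
    · rintro h ⟨y, hy⟩
      have h1 : (g * y * g⁻¹) • g • x = g • x := h ⟨_, y, hy, rfl⟩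
      rw [mul_smul, mul_smul, inv_smul_smul] at h1
      exact smul_left_cancel g h1
  rw [map_sub, map_sub, key, key]

/-- The class of the transitive `G`-set `G ⧸ H`. -/
noncomputable def ofQuotient [Finite G] (H : Subgroup G) : BurnsideRing G :=
  ofSet ⟨G ⧸ H⟩

/-- A coset `xH` fixed by `K` gives `x⁻¹Kx ≤ H`. This is the triangularity of the table of marks. -/
theorem exists_le_conj_of_mark_ofQuotient_ne_zero [Finite G] {H K : Subgroup G}
    (h : mark K (ofQuotient H) ≠ 0) : ∃ g : G, K ≤ H.map (MulAut.conj g).toMonoidHom := by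
  rw [ofQuotient, mark_ofSet] at h
  have h' : Nat.card (MulAction.fixedPoints K (G ⧸ H)) ≠ 0 := by exact_mod_cast h
  obtain ⟨⟨⟨x⟩, hx⟩⟩ := (Nat.card_ne_zero.1 h').1
  refine ⟨x, fun k hk => ⟨x⁻¹ * k * x, ?_, by simp [mul_assoc]⟩⟩
  have h1 : ((k * x : G) : G ⧸ H) = (x : G ⧸ H) := hx ⟨k, hk⟩
  have h2 := QuotientGroup.eq.1 h1.symm
  rwa [← mul_assoc] at h2

/-- The `H`-fixed cosets in `G ⧸ H` form `N(H)/H`: the diagonal of the table of marks. -/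
theorem mark_ofQuotient_self [Finite G] (H : Subgroup G) :
    mark H (ofQuotient H) * Nat.card H = Nat.card (normalizer (H : Set G)) := by
  rw [ofQuotient, mark_ofSet]
  norm_cast
  change Nat.card (MulAction.fixedPoints H (G ⧸ H)) * _ = _
  rw [Nat.card_congr (Sylow.fixedPointsMulLeftCosetsEquivQuotient H),
    card_eq_card_quotient_mul_card_subgroup (H.subgroupOf (normalizer (H : Set G))),
    Nat.card_congr (subgroupOfEquivOfLe (le_normalizer (H := H))).toEquiv]
  rfl

/-- The Cauchy–Frobenius congruence for the action of `Q` on the `P`-fixed points. -/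
theorem card_dvd_sum_mark {Q : Type*} [Group Q] [Fintype Q] (θ : Q →* G) (P : Subgroup G)
    (hθ : ∀ n, θ n ∈ normalizer (P : Set G)) (x : BurnsideRing G) :
    (Nat.card Q : ℤ) ∣ ∑ n : Q, mark (P ⊔ zpowers (θ n)) x := by
  obtain ⟨X, Y, rfl⟩ := exists_ofSet_sub x
  have key : ∀ X : FinGSet G,
      (Nat.card Q : ℤ) ∣ ∑ n : Q, mark (P ⊔ zpowers (θ n)) (ofSet X) := by
    intro X
    classical
    let : MulAction Q X.carrier := MulAction.compHom _ θ
    have hsmul : ∀ (n : Q) (x : X.carrier), n • x = θ n • x := fun _ _ => rfl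
    let Z : SubMulAction Q X.carrier :=
      { carrier := MulAction.fixedPoints P X.carrier
        smul_mem' := by
          rintro n x hx ⟨k, hk⟩
          have h1 := ((mem_normalizer_iff.1 (inv_mem (hθ n))) k).1 hk
          have h2 : ((θ n)⁻¹ * k * (θ n)⁻¹⁻¹) • x = x := hx ⟨_, h1⟩
          change k • θ n • x = θ n • x
          rw [inv_inv, mul_smul, mul_smul, inv_smul_eq_iff] at h2
          exact h2 }
    have : Finite Z := inferInstanceAs (Finite (MulAction.fixedPoints P X.carrier))
    let _ := Fintype.ofFinite Z
    let _ := Fintype.ofFinite (Quotient (MulAction.orbitRel Q Z))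
    have h := MulAction.sum_card_fixedBy_eq_card_orbits_mul_card_group Q Z
    -- A point is fixed by `P` and by `θ n` exactly when its stabilizer contains `P ⊔ ⟨θ n⟩`.
    have h3 : ∀ n : Q, mark (P ⊔ zpowers (θ n)) (ofSet X) =
        (Fintype.card (MulAction.fixedBy Z n) : ℤ) := by
      intro n
      rw [mark_ofSet, ← Nat.card_eq_fintype_card]
      congr 1
      refine Nat.card_congr
        { toFun := fun x => ⟨⟨x.1, fun k => x.2 ⟨k, mem_sup_left k.2⟩⟩,
            Subtype.ext (x.2 ⟨θ n, mem_sup_right (mem_zpowers _)⟩)⟩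
          invFun := fun x => ⟨x.1.1, fun k => ?_⟩
          left_inv := fun _ => rfl
          right_inv := fun _ => rfl }
      have h4 : P ⊔ zpowers (θ n) ≤ MulAction.stabilizer G x.1.1 := by
        refine sup_le (fun k hk => x.1.2 ⟨k, hk⟩) ?_
        rw [zpowers_le]
        exact congrArg Subtype.val x.2
      exact h4 k.2
    simp only [h3]
    rw [← Nat.cast_sum, h, Nat.card_eq_fintype_card, Nat.cast_mul]
    exact dvd_mul_left _ _
  simp only [map_sub, Finset.sum_sub_distrib]
  exact dvd_sub (key X) (key Y)

/-- The complement of an orbit of a finite `G`-set. -/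
def _root_.FinGSet.orbitCompl (X : FinGSet G) (x : X.carrier) : FinGSet G :=
  letI Z : SubMulAction G X.carrier :=
    { carrier := (MulAction.orbit G x)ᶜ
      smul_mem' := fun g y hy h => hy (by
        rw [← inv_smul_smul g y]
        exact MulAction.mem_orbit_of_mem_orbit _ h) }
  ⟨Z⟩

theorem ofSet_eq_add_orbitCompl [Finite G] (X : FinGSet G) (x : X.carrier) :
    ofSet X = ofQuotient (MulAction.stabilizer G x) + ofSet (X.orbitCompl x) := by
  rw [ofQuotient, ← ofSet_sum]
  symm
  let f : (G ⧸ MulAction.stabilizer G x) ⊕ (X.orbitCompl x).carrier → X.carrier :=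
    Sum.elim (MulAction.ofQuotientStabilizer G x) Subtype.val
  have hf : ∀ a, MulAction.ofQuotientStabilizer G x a ∈ MulAction.orbit G x := by
    rintro ⟨g⟩
    exact ⟨g, rfl⟩
  refine ofSet_congr ⟨Equiv.ofBijective f ⟨?_, ?_⟩, ?_⟩
  · rintro (a | a) (b | b) hab
    · exact congrArg Sum.inl (MulAction.injective_ofQuotientStabilizer G x hab)
    · exact (b.2 (Eq.subst (motive := (· ∈ MulAction.orbit G x)) hab (hf a))).elim
    · exact (a.2 (Eq.subst (motive := (· ∈ MulAction.orbit G x)) hab.symm (hf b))).elim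
    · exact congrArg Sum.inr (Subtype.ext hab)
  · intro y
    by_cases hy : y ∈ MulAction.orbit G x
    · obtain ⟨g, rfl⟩ := hy
      exact ⟨Sum.inl g, rfl⟩
    · exact ⟨Sum.inr ⟨y, hy⟩, rfl⟩
  · rintro g (a | a)
    · exact MulAction.ofQuotientStabilizer_smul G x g a
    · rfl

theorem card_orbitCompl_lt (X : FinGSet G) (x : X.carrier) :
    Nat.card (X.orbitCompl x).carrier < Nat.card X.carrier := by
  have : Nat.card ↥(MulAction.orbit G x)ᶜ < Nat.card X.carrier := by
    rw [Nat.card_coe_set_eq, ← Set.ncard_univ]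
    refine Set.ncard_lt_ncard ⟨Set.subset_univ _, fun h => ?_⟩
    exact h (Set.mem_univ x) (MulAction.mem_orbit_self x)
  exact this

/-- Induction on `|X|`: equal marks force `X` and `Y` to share an orbit type, and removing one such
orbit from each keeps the marks equal. -/
theorem ofSet_eq_of_mark_eq [Finite G] {X Y : FinGSet G}
    (h : ∀ H : Subgroup G, mark H (ofSet X) = mark H (ofSet Y)) : ofSet X = ofSet Y := by
  induction hn : Nat.card X.carrier using Nat.strong_induction_on generalizing X Y with
  | _ n ih =>
    -- The stabilizer of `x` fixes `x`, so its mark on `Y` is nonzero as well.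
    have hpos : ∀ {X Y : FinGSet G}, (∀ H : Subgroup G, mark H (ofSet X) = mark H (ofSet Y)) →
        ∀ x : X.carrier, ∃ y : Y.carrier,
          MulAction.stabilizer G x ≤ MulAction.stabilizer G y := by
      intro X Y h x
      have h1 := h (MulAction.stabilizer G x)
      rw [mark_ofSet, mark_ofSet, Nat.cast_inj] at h1
      have : Nonempty (MulAction.fixedPoints (MulAction.stabilizer G x) X.carrier) :=
        ⟨⟨x, fun k => k.2⟩⟩
      have h2 := (Nat.card_pos (α := MulAction.fixedPoints (MulAction.stabilizer G x) X.carrier)).ne'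
      obtain ⟨⟨y, hy⟩⟩ := (Nat.card_ne_zero.1 (h1 ▸ h2)).1
      exact ⟨y, fun k hk => hy ⟨k, hk⟩⟩
    rcases isEmpty_or_nonempty X.carrier with hX | hX
    · have hY : IsEmpty Y.carrier :=
        ⟨fun y => hX.elim (hpos (fun H => (h H).symm) y).choose⟩
      exact ofSet_congr ⟨Equiv.equivOfIsEmpty _ _, fun _ x => hX.elim x⟩
    -- With the stabilizer of `x` of maximal order, passing to `y` in `Y` and back to `x'` in `X`
    -- cannot enlarge it, so `x` and `y` have the same stabilizer.
    · obtain ⟨x, hx⟩ := Finite.exists_max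
        (fun x : X.carrier => Nat.card (MulAction.stabilizer G x))
      obtain ⟨y, hy⟩ := hpos h x
      obtain ⟨x', hx'⟩ := hpos (fun H => (h H).symm) y
      have hxy : MulAction.stabilizer G x = MulAction.stabilizer G y :=
        eq_of_le_of_card_ge hy ((card_le_of_le hx').trans (hx x'))
      have hX := ofSet_eq_add_orbitCompl X x
      have hY := ofSet_eq_add_orbitCompl Y y
      rw [← hxy] at hY
      rw [hX, hY]
      congr 1
      refine ih _ (hn ▸ card_orbitCompl_lt X x) (fun H => ?_) rfl
      have h1 := h H
      rw [hX, hY, map_add, map_add] at h1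
      exact add_left_cancel h1

/-- The elements of the Burnside ring are detected by their marks. -/
theorem ext_mark [Finite G] {x y : BurnsideRing G} (h : ∀ H : Subgroup G, mark H x = mark H y) :
    x = y := by
  rw [← sub_eq_zero]
  obtain ⟨X, Y, hXY⟩ := exists_ofSet_sub (x - y)
  rw [hXY, sub_eq_zero]
  refine ofSet_eq_of_mark_eq fun H => ?_
  rw [← sub_eq_zero, ← map_sub, ← hXY, map_sub, h H, sub_self]

/-- A class function on subgroups is a function of marks if it satisfies, at each prime, the
Cauchy–Frobenius congruences. -/
theorem exists_mark_eq [Finite G] (ξ : Subgroup G → ℤ)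
    (hconj : ∀ (H : Subgroup G) (g : G), ξ (H.map (MulAut.conj g).toMonoidHom) = ξ H)
    (hcong : ∀ (q : ℕ) [Fact q.Prime] (H Q : Subgroup G) [Fintype Q], IsPGroup q Q →
      Q ≤ normalizer (H : Set G) → (Nat.card Q : ℤ) ∣ ∑ n : Q, ξ (H ⊔ zpowers (n : G))) :
    ∃ x : BurnsideRing G, ∀ H, mark H x = ξ H := by
  classical
  let _ := Fintype.ofFinite (Subgroup G)
  -- Induction on a downward closed set `s` containing the support of `ξ`: a multiple of `[G ⧸ H]`,
  -- with `H` maximal in `s`, is subtracted to clear the value at `H`.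
  suffices key : ∀ (s : Finset (Subgroup G)), (∀ H ∈ s, ∀ K ≤ H, K ∈ s) → ∀ ξ : Subgroup G → ℤ,
      (∀ (H : Subgroup G) (g : G), ξ (H.map (MulAut.conj g).toMonoidHom) = ξ H) →
      (∀ (q : ℕ) [Fact q.Prime] (H Q : Subgroup G) [Fintype Q], IsPGroup q Q →
        Q ≤ normalizer (H : Set G) → (Nat.card Q : ℤ) ∣ ∑ n : Q, ξ (H ⊔ zpowers (n : G))) →
      (∀ H, ξ H ≠ 0 → H ∈ s) → ∃ x : BurnsideRing G, ∀ H, mark H x = ξ H from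
    key Finset.univ (by simp) ξ hconj hcong (by simp)
  clear hconj hcong ξ
  intro s
  induction s using Finset.strongInduction with
  | _ s ih =>
    intro hs ξ hconj hcong hsupp
    rcases s.eq_empty_or_nonempty with rfl | hne
    · refine ⟨0, fun H => ?_⟩
      rw [map_zero]
      by_contra h
      exact absurd (hsupp H (Ne.symm h)) (Finset.notMem_empty _)
    obtain ⟨H, hH⟩ := s.exists_maximal hne
    have hlower : ∀ L ∈ s.erase H, ∀ K ≤ L, K ∈ s.erase H := by
      intro L hL K hKL
      rw [Finset.mem_erase] at hL ⊢
      refine ⟨?_, hs L hL.2 K hKL⟩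
      rintro rfl
      exact hL.1 (le_antisymm (hH.2 hL.2 hKL) hKL)
    -- For each prime power `q ^ k` dividing `|N(H)|`, the congruence is used for a subgroup `Q` of
    -- that order. By maximality of `H` only the terms with `n ∈ H` survive, and the sum is `|Q ∩ H|
    -- ξ(H)`.
    have hdvd : (Nat.card (normalizer (H : Set G)) : ℤ) ∣ Nat.card H * ξ H := by
      rw [← Int.natAbs_dvd_natAbs, Int.natAbs_mul, Int.natAbs_natCast, Int.natAbs_natCast,
        Nat.dvd_iff_prime_pow_dvd_dvd]
      intro q k hq hqk
      have : Fact q.Prime := ⟨hq⟩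
      obtain ⟨Q', hQ'⟩ := Sylow.exists_subgroup_card_pow_prime q hqk
      set Q := Q'.map (normalizer (H : Set G)).subtype with hQdef
      have hQN : Q ≤ normalizer (H : Set G) := map_subtype_le _
      have hQ : Nat.card Q = q ^ k := by
        rw [hQdef, card_map_of_injective (subtype_injective _), hQ']
      let _ := Fintype.ofFinite Q
      have h1 := hcong q H Q (IsPGroup.of_card hQ) hQN
      have h2 : ∀ n : Q, ξ (H ⊔ zpowers (n : G)) = if (n : G) ∈ H then ξ H else 0 := by
        intro n
        split_ifs with hn
        · rw [sup_eq_left.2 ((zpowers_le).2 hn)]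
        · by_contra h
          exact hn (hH.2 (hsupp _ h) le_sup_left (mem_sup_right (mem_zpowers _)))
      simp only [h2] at h1
      rw [Finset.sum_ite, Finset.sum_const_zero, add_zero, Finset.sum_const, nsmul_eq_mul] at h1
      have h3 : (Finset.univ.filter fun n : Q => (n : G) ∈ H).card = Nat.card (H.subgroupOf Q) := by
        rw [← Fintype.card_subtype, ← Nat.card_eq_fintype_card]
        rfl
      have h4 : Nat.card (H.subgroupOf Q) ∣ Nat.card H :=
        card_comap_dvd_of_injective H Q.subtype (subtype_injective _)
      rw [h3, ← Int.natAbs_dvd_natAbs, Int.natAbs_mul, Int.natAbs_natCast, Int.natAbs_natCast,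
        hQ] at h1
      exact h1.trans (mul_dvd_mul_right h4 _)
    obtain ⟨c, hc⟩ : ∃ c : ℤ, ξ H = c * mark H (ofQuotient H) := by
      obtain ⟨c, hc⟩ := hdvd
      refine ⟨c, ?_⟩
      rw [← mark_ofQuotient_self] at hc
      have h0 : (Nat.card H : ℤ) ≠ 0 := by exact_mod_cast Nat.card_pos.ne'
      apply mul_left_cancel₀ h0
      rw [hc]
      ring
    obtain ⟨x, hx⟩ := ih (s.erase H) (Finset.erase_ssubset hH.1) hlower
      (fun K => ξ K - c * mark K (ofQuotient H))
      (fun K g => by rw [hconj, mark_map_conj])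
      (fun q _ K Q _ hQ hQK => by
        rw [Finset.sum_sub_distrib, ← Finset.mul_sum]
        exact dvd_sub (hcong q K Q hQ hQK) (Dvd.dvd.mul_left
          (card_dvd_sum_mark Q.subtype K (fun n => hQK n.2) (ofQuotient H)) c))
      -- `s` need not be closed under conjugation. If the subtracted term is nonzero at `K`, then
      -- `K` lies in a conjugate of `H` at which `ξ` equals `ξ(H) ≠ 0`; that conjugate is in `s`,
      -- hence so is `K`.
      (fun K hK => by
        rw [Finset.mem_erase]
        refine ⟨fun h => hK (by rw [h, hc, sub_self]), ?_⟩
        by_contra hKs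
        have h1 : ξ K = 0 := by
          by_contra h
          exact hKs (hsupp K h)
        rw [h1, zero_sub, neg_ne_zero] at hK
        obtain ⟨g, hg⟩ := exists_le_conj_of_mark_ofQuotient_ne_zero (right_ne_zero_of_mul hK)
        have h2 : ξ H ≠ 0 := by
          intro h
          rw [h] at hc
          rcases mul_eq_zero.1 hc.symm with h3 | h3
          · exact left_ne_zero_of_mul hK h3
          · have h4 := mark_ofQuotient_self H
            rw [h3, zero_mul] at h4
            exact Nat.card_pos.ne' (by exact_mod_cast h4.symm : Nat.card (normalizer (H : Set G)) = 0)
        exact hKs (hs _ (hsupp _ (by rwa [hconj])) K hg))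
    refine ⟨x + c * ofQuotient H, fun K => ?_⟩
    rw [map_add, map_mul, hx, map_intCast]
    simp

end Marks

end BurnsideRing

/-! ### Fusion in `G` and the marks of the transfer -/

section Transfer

variable {G : Type u} [Group G]

theorem FusionSystem.frobenius_isConj {S : Subgroup G} {P P' : Subgroup S} {g : G}
    (h : (P.map S.subtype).map (MulAut.conj g).toMonoidHom = P'.map S.subtype) :
    (frobenius S).IsConj P P' := by
  have mem : ∀ x : P, ∃ y : P', ((y : S) : G) = g * ((x : S) : G) * g⁻¹ := by
    intro x
    have h1 : g * ((x : S) : G) * g⁻¹ ∈ P'.map S.subtype := by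
      rw [← h]
      exact ⟨_, ⟨x, x.2, rfl⟩, rfl⟩
    obtain ⟨y, hy, hxy⟩ := h1
    exact ⟨⟨y, hy⟩, hxy⟩
  have mem' : ∀ y : P', ∃ x : P, ((y : S) : G) = g * ((x : S) : G) * g⁻¹ := by
    intro y
    have h1 : ((y : S) : G) ∈ P'.map S.subtype := ⟨y, y.2, rfl⟩
    rw [← h] at h1
    obtain ⟨_, ⟨x, hx, rfl⟩, hxy⟩ := h1
    exact ⟨⟨x, hx⟩, hxy.symm⟩
  choose f hf using mem
  let φ : P →* P' := MonoidHom.mk' f fun a b => by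
    refine Subtype.ext (Subtype.ext ?_)
    change ((f (a * b) : S) : G) = (f a : S) * (f b : S)
    rw [hf, hf, hf]
    simp [mul_assoc]
  have hφ : ∀ x, ((φ x : S) : G) = g * ((x : S) : G) * g⁻¹ := hf
  have hbij : Function.Bijective φ := by
    constructor
    · intro a b hab
      have h1 := hφ a
      rw [hab, hφ b] at h1
      exact Subtype.ext (Subtype.ext (mul_left_cancel (mul_right_cancel h1)).symm)
    · intro y
      obtain ⟨x, hx⟩ := mem' y
      exact ⟨x, Subtype.ext (Subtype.ext ((hφ x).trans hx.symm))⟩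
  refine ⟨MulEquiv.ofBijective φ hbij, ⟨g, hφ⟩, ⟨g⁻¹, fun y => ?_⟩⟩
  obtain ⟨x, rfl⟩ := (MulEquiv.ofBijective φ hbij).surjective y
  have h1 : (((MulEquiv.ofBijective φ hbij x : P') : S) : G) = g * ((x : S) : G) * g⁻¹ := hφ x
  change ((((MulEquiv.ofBijective φ hbij).symm (MulEquiv.ofBijective φ hbij x) : P) : S) : G) = _
  rw [MulEquiv.symm_apply_apply, h1]
  simp [mul_assoc]

theorem FusionSystem.exists_conj_of_frobenius_isConj {S : Subgroup G} {P P' : Subgroup S}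
    (h : (frobenius S).IsConj P P') :
    ∃ g : G, (P.map S.subtype).map (MulAut.conj g).toMonoidHom = P'.map S.subtype := by
  obtain ⟨e, ⟨g, hg⟩, -⟩ := h
  refine ⟨g, le_antisymm ?_ ?_⟩
  · rintro _ ⟨_, ⟨x, hx, rfl⟩, rfl⟩
    exact ⟨e ⟨x, hx⟩, (e ⟨x, hx⟩).2, hg ⟨x, hx⟩⟩
  · rintro _ ⟨y, hy, rfl⟩
    refine ⟨_, ⟨e.symm ⟨y, hy⟩, (e.symm ⟨y, hy⟩).2, rfl⟩, ?_⟩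
    refine (hg (e.symm ⟨y, hy⟩)).symm.trans ?_
    change ((e (e.symm ⟨y, hy⟩) : S) : G) = y
    rw [e.apply_symm_apply]

variable {p : ℕ} [Fact p.Prime]

/-- The subgroup `P` of `S` is `G`-conjugate to a Sylow `p`-subgroup of `H`. -/
def Subgroup.IsConjSylowIn (p : ℕ) {S : Subgroup G} (P : Subgroup S) (H : Subgroup G) : Prop :=
  ∃ (R : Subgroup G) (g : G), IsSylowIn p R H ∧
    P.map S.subtype = R.map (MulAut.conj g).toMonoidHom

/-- By Sylow's theorem in `H`. This makes the marks of the transfer independent of choices. -/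
theorem Subgroup.IsConjSylowIn.isConj [Finite G] {S : Subgroup G} {P P' : Subgroup S}
    {H : Subgroup G} (h : IsConjSylowIn p P H) (h' : IsConjSylowIn p P' H) :
    (FusionSystem.frobenius S).IsConj P P' := by
  obtain ⟨R, g, hR, hP⟩ := h
  obtain ⟨R', g', hR', hP'⟩ := h'
  obtain ⟨k, rfl⟩ := hR.exists_conj hR'
  refine FusionSystem.frobenius_isConj (g := g' * k * g⁻¹) ?_
  rw [hP, hP', map_conj_mul, map_conj_mul, inv_mul_cancel_right]

theorem Subgroup.exists_map_subtype_eq {S K : Subgroup G} (h : K ≤ S) :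
    ∃ P : Subgroup S, P.map S.subtype = K :=
  ⟨K.subgroupOf S, by rw [subgroupOf_map_subtype, inf_eq_left.2 h]⟩

theorem Sylow.exists_isConjSylowIn [Finite G] (S : Sylow p G) (H : Subgroup G) :
    ∃ P : Subgroup (S : Subgroup G), IsConjSylowIn p P H := by
  obtain ⟨Q⟩ := (inferInstance : Nonempty (Sylow p H))
  obtain ⟨g, hg⟩ := (Q.2.map H.subtype).exists_map_conj_le S
  obtain ⟨P, hP⟩ := exists_map_subtype_eq hg
  exact ⟨P, _, g, ⟨Q, rfl⟩, hP⟩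

theorem Subgroup.IsConjSylowIn.map_conj [Finite G] {S : Subgroup G} {P : Subgroup S}
    {H : Subgroup G} (h : IsConjSylowIn p P H) (g : G) :
    IsConjSylowIn p P (H.map (MulAut.conj g).toMonoidHom) := by
  obtain ⟨R, k, hR, hP⟩ := h
  refine ⟨_, k * g⁻¹, hR.map_conj g, ?_⟩
  rw [hP, map_conj_mul, inv_mul_cancel_right]

/-- A `p`-group is its own Sylow `p`-subgroup; hence the transfer is a section of restriction. -/
theorem IsPGroup.isConjSylowIn_map_subtype [Finite G] {S : Subgroup G} {P : Subgroup S}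
    (hS : IsPGroup p S) : IsConjSylowIn p P (P.map S.subtype) := by
  refine ⟨P.map S.subtype, 1, isSylowIn_iff.2 ⟨le_rfl, ?_, ?_⟩, (map_conj_one _).symm⟩
  · exact (hS.to_subgroup P).map _
  · rw [relIndex_self, Nat.dvd_one]
    exact (Fact.out : p.Prime).ne_one

/-- The mark at `H` of the transfer of `b`: the mark of `b` at a Sylow `p`-subgroup of `H`. -/
noncomputable def FusionSystem.sylowMarks [Finite G] (S : Sylow p G) :
    (frobenius (S : Subgroup G)).burnsideRing →+* (Subgroup G → ℤ) :=
  RingHom.pi fun H => (BurnsideRing.mark (S.exists_isConjSylowIn H).choose).comp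
    (frobenius (S : Subgroup G)).burnsideRing.subtype

theorem FusionSystem.sylowMarks_eq [Finite G] (S : Sylow p G)
    (b : (frobenius (S : Subgroup G)).burnsideRing) {P : Subgroup (S : Subgroup G)}
    {H : Subgroup G} (h : IsConjSylowIn p P H) :
    sylowMarks S b H = BurnsideRing.mark P (b : BurnsideRing (S : Subgroup G)) :=
  b.2 _ _ ((S.exists_isConjSylowIn H).choose_spec.isConj h)

/-- The Sylow subgroups `P⟨n⟩` of `H⟨n⟩` all lie in one `p`-group `T`, so a single `g` conjugates
them into `S`. The sum is then the Cauchy–Frobenius sum of `b` for `Q` acting through `θ`. -/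
theorem FusionSystem.card_dvd_sum_sylowMarks [Finite G] (S : Sylow p G)
    (b : (frobenius (S : Subgroup G)).burnsideRing) {H Q : Subgroup G} [Fintype Q]
    (hQ : IsPGroup p Q) (hQH : Q ≤ normalizer (H : Set G)) :
    (Nat.card Q : ℤ) ∣ ∑ n : Q, sylowMarks S b (H ⊔ zpowers (n : G)) := by
  obtain ⟨T, P, hT, hQT, hPT, hQP, hn⟩ := hQ.exists_isSylowIn_sup_zpowers hQH
  obtain ⟨g, hg⟩ := hT.exists_map_conj_le S
  obtain ⟨P', hP'⟩ := exists_map_subtype_eq ((map_mono hPT).trans hg)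
  let θ : Q →* (S : Subgroup G) := ((MulAut.conj g).toMonoidHom.comp Q.subtype).codRestrict
    (S : Subgroup G) fun n => hg ⟨n, hQT n.2, rfl⟩
  have hθ : ∀ n : Q, ((θ n : (S : Subgroup G)) : G) = (MulAut.conj g).toMonoidHom (n : G) :=
    fun _ => rfl
  have hmem : ∀ x : (S : Subgroup G), x ∈ P' ↔ g⁻¹ * (x : G) * g ∈ P := by
    intro x
    rw [← mem_map_iff_mem (Subgroup.subtype_injective (S : Subgroup G)), hP', mem_map_equiv]
    simp
  have h := BurnsideRing.card_dvd_sum_mark θ P' (fun n => ?_) b.1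
  · refine h.trans (dvd_of_eq (Finset.sum_congr rfl fun n _ => ?_))
    refine (sylowMarks_eq S b ⟨_, g, hn n n.2, ?_⟩).symm
    rw [Subgroup.map_sup, Subgroup.map_sup, hP', MonoidHom.map_zpowers, MonoidHom.map_zpowers]
    rfl
  · rw [mem_normalizer_iff]
    intro x
    rw [hmem, hmem, mem_normalizer_iff.1 (hQP n.2)]
    rw [coe_mul, coe_mul, coe_inv, hθ]
    simp [mul_assoc]

theorem FusionSystem.exists_mark_eq_sylowMarks [Finite G] (S : Sylow p G)
    (b : (frobenius (S : Subgroup G)).burnsideRing) :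
    ∃ x : BurnsideRing G, ∀ H, BurnsideRing.mark H x = sylowMarks S b H := by
  refine BurnsideRing.exists_mark_eq _ (fun H g => ?_) fun q _ H Q _ hQ hQH => ?_
  · rw [sylowMarks_eq S b ((S.exists_isConjSylowIn H).choose_spec.map_conj g)]
    rfl
  · rcases eq_or_ne q p with rfl | hqp
    · exact card_dvd_sum_sylowMarks S b hQ hQH
    -- `[H⟨n⟩ : H]` divides `|Q|`, a power of `q ≠ p`, so a Sylow `p`-subgroup of `H` remains Sylow
    -- in `H⟨n⟩` and the sum is `|Q|` times a constant.
    · have key : ∀ n : Q, sylowMarks S b (H ⊔ zpowers (n : G)) = sylowMarks S b H := by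
        intro n
        obtain ⟨P, R, g, hR, hP⟩ := S.exists_isConjSylowIn H
        rw [sylowMarks_eq S b ⟨R, g, hR, hP⟩]
        refine sylowMarks_eq S b ⟨R, g, ?_, hP⟩
        rw [isSylowIn_iff] at hR ⊢
        refine ⟨hR.1.trans le_sup_left, hR.2.1, ?_⟩
        have hnQ : zpowers (n : G) ≤ Q := by simp
        have hnH := hnQ.trans hQH
        rw [← relIndex_mul_relIndex R H _ hR.1 le_sup_left, (Fact.out : p.Prime).dvd_mul]
        rintro (h | h)
        · exact hR.2.2 h
        · have h1 : H.relIndex (H ⊔ zpowers (n : G)) ∣ Nat.card Q := by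
            rw [← relIndex_subgroupOf (sup_le le_normalizer hnH),
              subgroupOf_sup le_normalizer hnH, relIndex_sup_left,
              relIndex_subgroupOf hnH]
            exact (relIndex_dvd_card _ _).trans (card_dvd_of_le hnQ)
          obtain ⟨k, hk⟩ := (IsPGroup.iff_card.1 hQ)
          rw [hk] at h1
          exact hqp.symm ((Nat.prime_dvd_prime_iff_eq Fact.out Fact.out).1
            ((Fact.out : p.Prime).dvd_of_dvd_pow (h.trans h1)))
      simp only [key, Finset.sum_const, Finset.card_univ, nsmul_eq_mul, Nat.card_eq_fintype_card]
      exact dvd_mul_right _ _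

end Transfer

theorem theorem7p1 {G : Type u} [Group G] [Finite G] (p : ℕ) [Fact p.Prime] (S : Sylow p G) :
    (BurnsideRing.res (S : Subgroup G)).range =
        (FusionSystem.frobenius (S : Subgroup G)).burnsideRing ∧
      ∃ t : (FusionSystem.frobenius (S : Subgroup G)).burnsideRing →+* BurnsideRing G,
        Function.Injective t ∧
          (∀ b, BurnsideRing.res (S : Subgroup G) (t b) = b) ∧
          ∀ b (H : Subgroup G) (Q : Sylow p H) (P : Subgroup (S : Subgroup G)) (g : G),
            P.map (S : Subgroup G).subtype =
                (Q.toSubgroup.map H.subtype).map (MulAut.conj g).toMonoidHom →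
              BurnsideRing.mark H (t b) = BurnsideRing.mark P (b : BurnsideRing (S : Subgroup G)) := by
  choose τ hτ using FusionSystem.exists_mark_eq_sylowMarks S
  -- The chosen preimages respect the ring operations because marks separate elements and
  -- `sylowMarks S` is a ring homomorphism.
  let t : (FusionSystem.frobenius (S : Subgroup G)).burnsideRing →+* BurnsideRing G :=
    { toFun := τ
      map_one' := BurnsideRing.ext_mark fun H => by rw [hτ, map_one, map_one]; rfl
      map_zero' := BurnsideRing.ext_mark fun H => by rw [hτ, map_zero, map_zero]; rfl
      map_add' := fun a b => BurnsideRing.ext_mark fun H => by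
        rw [hτ, map_add, map_add, hτ, hτ]; rfl
      map_mul' := fun a b => BurnsideRing.ext_mark fun H => by
        rw [hτ, map_mul, map_mul, hτ, hτ]; rfl }
  have ht : ∀ b H, BurnsideRing.mark H (t b) = FusionSystem.sylowMarks S b H := hτ
  have hres : ∀ b, BurnsideRing.res (S : Subgroup G) (t b) = b := fun b =>
    BurnsideRing.ext_mark fun P => by
      rw [BurnsideRing.mark_res, ht]
      exact FusionSystem.sylowMarks_eq S b S.2.isConjSylowIn_map_subtype
  refine ⟨le_antisymm ?_ fun b hb => ⟨t ⟨b, hb⟩, hres ⟨b, hb⟩⟩, t, fun a b hab => ?_, hres, ?_⟩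
  · rintro _ ⟨x, rfl⟩ P P' h
    obtain ⟨g, hg⟩ := FusionSystem.exists_conj_of_frobenius_isConj h
    rw [BurnsideRing.mark_res, BurnsideRing.mark_res, ← hg, BurnsideRing.mark_map_conj]
  · exact Subtype.ext (by rw [← hres a, hab, hres b])
  · intro b H Q P g h
    rw [ht]
    exact FusionSystem.sylowMarks_eq S b ⟨_, g, ⟨Q, rfl⟩, h⟩
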